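/- **Conventions.** Fix an o-minimal structure over $\mathbb R$ expanding the real field (for instance, the semialgebraic sets); all sets and maps below are required to be definable in it. The empty set counts as connected. A *coordinate cone* in $\mathbb R^n$ is a set $\{x : x_j\,\sigma_j\,c_j \text{ for } j\in J\}$ with $J\subset\{1,\dots,n\}$, $\sigma_j\in\{<,=,>\}$, $c_j\in\mathbb R$. An open bounded set $X\subset\mathbb R^n$ is *semi-monotone* if $X\cap C$ is connected for every coordinate cone $C$. A bounded upper semicontinuous function $f$ on a non-empty semi-monotone set $X$ is *submonotone* if $\{x\in X : f(x)<b\}$ is semi-monotone for every $b\in\mathbb R$, and $f$ is *supermonotone* if $-f$ is submonotone. A function $f$ on $X$ is *independent of* $x_j$ if $f(x)=f(y)$ whenever $x,y\in X$ differ only in the $j$-th coordinate. A function on $X$ is *monotone* if it is both submonotone and supermonotone and, for each $j$, it is either strictly increasing in $x_j$, or strictly decreasing in $x_j$, or independent of $x_j$ on $X$. Let $X\subset\mathbb R^n$ be non-empty and semi-monotone and let $f=(f_1,\dots,f_k):X\to\mathbb R^k$ be bounded and continuous, with graph $F\subset\mathbb R^{n+k}$ in the coordinates $x_1,\dots,x_n,y_1,\dots,y_k$.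 A set $H$ of $n$ of these $n+k$ coordinates is a *basis set* of $f$ if the projection of $F$ to the coordinates in $H$ is injective. The map $f$ is *monotone* in the following cases, by induction on $n$. If $n=0$, always. If $n=1$, when each $f_i$ is a monotone function. If $n\ge 2$, when for all $i,j$ such that $f_i$ is not independent of $x_j$: 1. for every $b\in\mathbb R$ the set $F\cap\{y_i=b\}$, considered in the space of all coordinates except $y_i$, is, when non-empty, the graph of a monotone map $f_{i,j,b}$ from a semi-monotone subset of $\operatorname{span}\{x_1,\dots,x_{j-1},x_{j+1},\dots,x_n\}$ to $\operatorname{span}\{y_1,\dots,y_{i-1},x_j,y_{i+1},\dots,y_k\}$; and 2. the system of basis sets of $f_{i,j,b}$ is the same for all $b$ for which this set is non-empty. (In particular, for $k=0$ the graphs of monotone maps are the non-empty semi-monotone sets.) **Theorem.** Let $d,n\ge 0$, let $\mathbf a_1,\dots,\mathbf a_n\in\mathbb N^d$ (where $0\in\mathbb N$), and let $$C=\{(\mathbf t^{\mathbf a_1},\dots,\mathbf t^{\mathbf a_n}) : \mathbf t\in(0,1)^d\}\subset\mathbb R^n,\qquad \mathbf t^{\mathbf a_i}=t_1^{a_{i,1}}\cdots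 t_d^{a_{i,d}},$$ be the corresponding open toric cube. Then $C$ is the graph of a monotone map: the coordinates of $\mathbb R^n$ can be split into $m$ coordinates and the $k=n-m$ remaining ones so that, in these coordinates, $C$ is the graph of a monotone map $f:X\to\mathbb R^k$ on a non-empty semi-monotone set $X\subset\mathbb R^m$. -/

import Mathlib

/-- An o-minimal structure over `ℝ`, expanding the real field: for each `n` a Boolean algebra of
"definable" subsets of `ℝⁿ`, containing the real algebraic sets, closed under products and under
projections, such that the definable subsets of `ℝ` are finite unions of points and intervals
(the order-connected subsets of `ℝ` are exactly the intervals, points and the empty set included;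
that every such finite union is definable follows from the other axioms). -/
structure OMinimalStructure where
  /-- the definable subsets of `ℝⁿ` -/
  Definable : ∀ {n : ℕ}, Set (Fin n → ℝ) → Prop
  compl : ∀ {n : ℕ} {A : Set (Fin n → ℝ)}, Definable A → Definable Aᶜ
  union : ∀ {n : ℕ} {A B : Set (Fin n → ℝ)}, Definable A → Definable B → Definable (A ∪ B)
  algebraic : ∀ {n : ℕ} (p : MvPolynomial (Fin n) ℝ),
    Definable {x : Fin n → ℝ | MvPolynomial.eval x p = 0}
  prod : ∀ {m n : ℕ} {A : Set (Fin m → ℝ)} {B : Set (Fin n → ℝ)}, Definable A → Definable B →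
    Definable {z : Fin (m + n) → ℝ |
      (fun i => z (Fin.castAdd n i)) ∈ A ∧ (fun i => z (Fin.natAdd m i)) ∈ B}
  proj : ∀ {n : ℕ} {A : Set (Fin (n + 1) → ℝ)}, Definable A →
    Definable ((fun (x : Fin (n + 1) → ℝ) (i : Fin n) => x i.castSucc) '' A)
  o_minimal : ∀ {A : Set (Fin 1 → ℝ)}, Definable A →
    ∃ T : Set (Set ℝ), T.Finite ∧ (∀ I ∈ T, I.OrdConnected) ∧
      {x : ℝ | (fun _ => x) ∈ A} = ⋃₀ T

/-- A coordinate cone in `ℝⁿ`: an intersection of sets `{x_j σ_j c_j}` over a set `J` of distinct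
coordinates, each `σ_j` being one of `<`, `=`, `>`. -/
def IsCoordinateCone {n : ℕ} (C : Set (Fin n → ℝ)) : Prop :=
  ∃ (J : Finset (Fin n)) (σ : Fin n → Ordering) (c : Fin n → ℝ),
    C = {x | ∀ j ∈ J, (σ j).Compares (x j) (c j)}

/-- Semi-monotone sets: definable open bounded sets (possibly empty) whose intersection with each
coordinate cone is connected, where the empty set counts as connected. -/
structure IsSemiMonotone (𝒮 : OMinimalStructure) {n : ℕ} (X : Set (Fin n → ℝ)) : Prop where
  definable : 𝒮.Definable X
  isOpen : IsOpen X
  isBounded : Bornology.IsBounded X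
  connected : ∀ C : Set (Fin n → ℝ), IsCoordinateCone C → IsPreconnected (X ∩ C)

/-- The graph `{(x, y) | x ∈ X, y = f x}` in `ℝⁿ⁺ᵏ` of the map `f : X → ℝᵏ`. Here and below, the
values of `f` outside of `X` play no role. -/
def mapGraph {n k : ℕ} (X : Set (Fin n → ℝ)) (f : (Fin n → ℝ) → (Fin k → ℝ)) :
    Set (Fin (n + k) → ℝ) :=
  {z | ∃ x ∈ X, z = Fin.append x (f x)}

/-- A submonotone function on the non-empty semi-monotone set `X`. -/
structure IsSubmonotone (𝒮 : OMinimalStructure) {n : ℕ} (X : Set (Fin n → ℝ))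
    (f : (Fin n → ℝ) → ℝ) : Prop where
  nonempty : X.Nonempty
  domain : IsSemiMonotone 𝒮 X
  definable : 𝒮.Definable (mapGraph X (fun x (_ : Fin 1) => f x))
  bounded : Bornology.IsBounded (f '' X)
  usc : UpperSemicontinuousOn f X
  sublevel : ∀ b : ℝ, IsSemiMonotone 𝒮 {x ∈ X | f x < b}

/-- A function `f` is supermonotone if `-f` is submonotone. -/
def IsSupermonotone (𝒮 : OMinimalStructure) {n : ℕ} (X : Set (Fin n → ℝ))
    (f : (Fin n → ℝ) → ℝ) : Prop :=
  IsSubmonotone 𝒮 X (fun x => -f x)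

/-- `f` is strictly increasing in the coordinate `x_j` on `X`. -/
def StrictIncrIn {n : ℕ} (X : Set (Fin n → ℝ)) (f : (Fin n → ℝ) → ℝ) (j : Fin n) : Prop :=
  ∀ x ∈ X, ∀ y ∈ X, (∀ l, l ≠ j → x l = y l) → x j < y j → f x < f y

/-- `f` is strictly decreasing in the coordinate `x_j` on `X`. -/
def StrictDecrIn {n : ℕ} (X : Set (Fin n → ℝ)) (f : (Fin n → ℝ) → ℝ) (j : Fin n) : Prop :=
  ∀ x ∈ X, ∀ y ∈ X, (∀ l, l ≠ j → x l = y l) → x j < y j → f y < f x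

/-- `f` is independent of the coordinate `x_j` on `X`. -/
def IndependentOf {n : ℕ} (X : Set (Fin n → ℝ)) (f : (Fin n → ℝ) → ℝ) (j : Fin n) : Prop :=
  ∀ x ∈ X, ∀ y ∈ X, (∀ l, l ≠ j → x l = y l) → f x = f y

/-- Monotone functions on a non-empty semi-monotone set `X`. -/
structure IsMonotoneFun (𝒮 : OMinimalStructure) {n : ℕ} (X : Set (Fin n → ℝ))
    (f : (Fin n → ℝ) → ℝ) : Prop where
  sub : IsSubmonotone 𝒮 X f
  super : IsSupermonotone 𝒮 X f
  coord : ∀ j : Fin n, StrictIncrIn X f j ∨ StrictDecrIn X f j ∨ IndependentOf X f j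

/-- The system of basis sets of `f : X → ℝᵏ`, `X ⊆ ℝⁿ`. The coordinates `x_1, …, x_n` are labelled
by `Sum.inl`, the coordinates `y_1, …, y_k` by `Sum.inr`. A set `H` of `n` of them is a basis if
the map from `X` to `ℝⁿ` formed by the coordinates in `H` of `(x, f x)` is injective. -/
def basisSets {n k : ℕ} (X : Set (Fin n → ℝ)) (f : (Fin n → ℝ) → (Fin k → ℝ)) :
    Set (Finset (Fin n ⊕ Fin k)) :=
  {H | H.card = n ∧ Set.InjOn (fun x (h : H) => Sum.elim x (f x) h.1) X}

/-- A definable, bounded and continuous map on a non-empty semi-monotone set. -/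
structure IsBoundedContinuousMap (𝒮 : OMinimalStructure) {n k : ℕ} (X : Set (Fin n → ℝ))
    (f : (Fin n → ℝ) → (Fin k → ℝ)) : Prop where
  nonempty : X.Nonempty
  domain : IsSemiMonotone 𝒮 X
  definable : 𝒮.Definable (mapGraph X f)
  bounded : Bornology.IsBounded (f '' X)
  continuousOn : ContinuousOn f X

/-- For the graph `F` of `f : X → ℝᵏ`, `X ⊆ ℝⁿ⁺¹`: the set `F ∩ {y_i = b}`, considered in
the space of all coordinates but `y_i`, is the graph of `g : X' → ℝᵏ`, where `X'` lies in the space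
of all `x`-coordinates but `x_j`, and where the `i`-th coordinate of the target of `g` is `x_j`. -/
def IsSliceGraph {n k : ℕ} (X : Set (Fin (n + 1) → ℝ)) (f : (Fin (n + 1) → ℝ) → (Fin k → ℝ))
    (i : Fin k) (j : Fin (n + 1)) (b : ℝ)
    (X' : Set (Fin n → ℝ)) (g : (Fin n → ℝ) → (Fin k → ℝ)) : Prop :=
  ∀ (x : Fin (n + 1) → ℝ) (y : Fin k → ℝ), y i = b →
    (Fin.append x y ∈ mapGraph X f ↔
      Fin.append (j.removeNth x) (Function.update y i (x j)) ∈ mapGraph X' g)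

/-- Monotone maps `f : X → ℝᵏ` on non-empty semi-monotone sets `X ⊆ ℝⁿ`, by induction on `n`.
For `n = 0` (where `X` is the point `ℝ⁰`) every map is monotone, and for `k = 0` every
non-empty semi-monotone set is the domain, and the graph, of a monotone map.
For `n ≥ 2`: whenever `f_i` is not independent of `x_j`, all non-empty slices `F ∩ {y_i = b}` of
the graph are graphs of monotone maps `f_{i,j,b}`, with one system `B` of basis sets common to
all `b`. -/
def IsMonotoneMap (𝒮 : OMinimalStructure) {k : ℕ} :
    (n : ℕ) → Set (Fin n → ℝ) → ((Fin n → ℝ) → (Fin k → ℝ)) → Prop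
  | 0, X, f => IsBoundedContinuousMap 𝒮 X f
  | 1, X, f => IsBoundedContinuousMap 𝒮 X f ∧ ∀ i : Fin k, IsMonotoneFun 𝒮 X (fun x => f x i)
  | n + 2, X, f => IsBoundedContinuousMap 𝒮 X f ∧
      ∀ (i : Fin k) (j : Fin (n + 2)), ¬ IndependentOf X (fun x => f x i) j →
        ∃ B : Set (Finset (Fin (n + 1) ⊕ Fin k)),
          ∀ b : ℝ, (∃ x ∈ X, f x i = b) →
            ∃ (X' : Set (Fin (n + 1) → ℝ)) (g : (Fin (n + 1) → ℝ) → (Fin k → ℝ)),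
              IsSliceGraph X f i j b X' g ∧ IsMonotoneMap 𝒮 (n + 1) X' g ∧ basisSets X' g = B

/-- `C ⊆ ℝⁿ` is the graph of a monotone map: after splitting the `n` coordinates of the ambient
space into `m` coordinates of the domain and `k` coordinates of the target (by the bijection `e`),
`C` is the graph of a monotone map `f : X → ℝᵏ` with `X ⊆ ℝᵐ`. -/
def IsGraphOfMonotoneMap (𝒮 : OMinimalStructure) {n : ℕ} (C : Set (Fin n → ℝ)) : Prop :=
  ∃ (m k : ℕ) (e : Fin (m + k) ≃ Fin n) (X : Set (Fin m → ℝ))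
    (f : (Fin m → ℝ) → (Fin k → ℝ)),
    IsMonotoneMap 𝒮 m X f ∧ C = {z | z ∘ e ∈ mapGraph X f}

/-- The open toric cube of `a_1, …, a_n ∈ ℕᵈ`: the image of `(0,1)ᵈ` under the monomial map
`t ↦ (t^{a_1}, …, t^{a_n})`. -/
def openToricCube {d n : ℕ} (a : Fin n → Fin d → ℕ) : Set (Fin n → ℝ) :=
  (fun (t : Fin d → ℝ) (i : Fin n) => ∏ l, t l ^ a i l) '' {t | ∀ l, t l ∈ Set.Ioo (0 : ℝ) 1}

/-!
In the logarithmic coordinates `u = log x` the open toric cube is the image of the open orthant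
`(-∞, 0)ᵈ` under a linear map, hence the graph of a linear map over an open convex set, once the
coordinates are split along a maximal linearly independent set of rows. It therefore suffices to
treat the graphs of maps that are affine in logarithmic coordinates over open convex sets `U`.

Since `exp` is increasing, the preimage under it of a coordinate cone is convex. So `exp U` is
semi-monotone, and a function on it is submonotone as soon as it is quasiconvex in logarithmic
coordinates. This applies to plus and minus the components of the map, because an affine functional
composed with a monotone function is both quasiconvex and quasiconcave.

Solving `y_i = b` for `x_j`, where `f_i` depends on `x_j`, gives again an affine map in logarithmic
coordinates over an open convex set, and `b` enters only its constant part. On an open set,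
injectivity of an affine map depends only on its linear part, so the basis sets are the same
for all `b`, and induction on `n` concludes.
-/

namespace OMinimalStructure

variable (𝒮 : OMinimalStructure) {n m : ℕ}

lemma definable_univ : 𝒮.Definable (Set.univ : Set (Fin n → ℝ)) := by
  simpa using 𝒮.algebraic (0 : MvPolynomial (Fin n) ℝ)

variable {𝒮} in
lemma Definable.inter {A B : Set (Fin n → ℝ)} (hA : 𝒮.Definable A) (hB : 𝒮.Definable B) :
    𝒮.Definable (A ∩ B) := by
  simpa only [Set.compl_union, compl_compl] using
    𝒮.compl (𝒮.union (𝒮.compl hA) (𝒮.compl hB))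

lemma definable_forall {ι : Type*} [Finite ι] {A : ι → Set (Fin n → ℝ)}
    (hA : ∀ i, 𝒮.Definable (A i)) : 𝒮.Definable {x | ∀ i, x ∈ A i} := by
  suffices h : ∀ s : Set ι, s.Finite → 𝒮.Definable (⋂ i ∈ s, A i) by
    simpa [Set.ofPred_forall] using h Set.univ Set.finite_univ
  intro s hs
  induction s, hs using Set.Finite.induction_on with
  | empty => simpa using 𝒮.definable_univ
  | insert _ _ ih => simpa only [Set.biInter_insert] using (hA _).inter ih

lemma definable_eval_eq (p q : MvPolynomial (Fin n) ℝ) :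
    𝒮.Definable {x | MvPolynomial.eval x p = MvPolynomial.eval x q} := by
  simpa [sub_eq_zero] using 𝒮.algebraic (p - q)

lemma definable_exists_append {A : Set (Fin (n + m) → ℝ)} (hA : 𝒮.Definable A) :
    𝒮.Definable {x : Fin n → ℝ | ∃ y : Fin m → ℝ, Fin.append x y ∈ A} := by
  have hproj : 𝒮.Definable ((fun (z : Fin (n + m) → ℝ) i => z (Fin.castAdd m i)) '' A) := by
    induction m with
    | zero => simpa using hA
    | succ m ih =>
      have h := ih (𝒮.proj (n := n + m) hA)
      rwa [Set.image_image] at h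
  convert hproj using 1
  ext x
  constructor
  · rintro ⟨y, hy⟩
    exact ⟨_, hy, by ext i; simp⟩
  · rintro ⟨z, hz, rfl⟩
    exact ⟨fun i => z (Fin.natAdd n i), by simpa [Fin.append_castAdd_natAdd] using hz⟩

lemma definable_eval_lt (p q : MvPolynomial (Fin n) ℝ) :
    𝒮.Definable {x | MvPolynomial.eval x p < MvPolynomial.eval x q} := by
  -- `p x < q x` if and only if `(q x - p x) * y ^ 2 = 1` has a solution `y`.
  have h := 𝒮.definable_exists_append (m := 1) (𝒮.definable_eval_eq
    (MvPolynomial.rename (Fin.castAdd 1) (q - p) * MvPolynomial.X (Fin.natAdd n 0) ^ 2) 1)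
  convert h using 1
  ext x
  have append_comp (y : Fin 1 → ℝ) : Fin.append x y ∘ Fin.castAdd 1 = x := by ext i; simp
  simp only [Set.mem_ofPred_eq, map_mul, map_pow, map_sub, MvPolynomial.eval_X,
    MvPolynomial.eval_rename, map_one, append_comp, Fin.append_right]
  rw [← sub_pos]
  constructor
  · intro hpos
    refine ⟨fun _ => (√(MvPolynomial.eval x q - MvPolynomial.eval x p))⁻¹, ?_⟩
    rw [inv_pow, Real.sq_sqrt hpos.le, mul_inv_cancel₀ hpos.ne']
  · rintro ⟨y, hy⟩
    exact pos_of_mul_pos_left (hy ▸ one_pos) (sq_nonneg _)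

variable {𝒮} in
lemma Definable.polynomial_image {A : Set (Fin m → ℝ)} (hA : 𝒮.Definable A)
    (p : Fin n → MvPolynomial (Fin m) ℝ) :
    𝒮.Definable ((fun x i => MvPolynomial.eval x (p i)) '' A) := by
  have h := 𝒮.definable_exists_append (Definable.inter (𝒮.prod (m := n) 𝒮.definable_univ hA)
    (𝒮.definable_forall fun i : Fin n => 𝒮.definable_eval_eq
      (MvPolynomial.rename (Fin.natAdd n) (p i)) (MvPolynomial.X (Fin.castAdd m i))))
  convert h using 1
  ext z
  have append_comp (x : Fin m → ℝ) : Fin.append z x ∘ Fin.natAdd n = x := by ext i; simp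
  simp [MvPolynomial.eval_rename, append_comp, funext_iff]

variable {𝒮} in
lemma Definable.image_comp {A : Set (Fin m → ℝ)} (hA : 𝒮.Definable A) (ρ : Fin n → Fin m) :
    𝒮.Definable ((· ∘ ρ) '' A) := by
  simpa [Function.comp_def] using hA.polynomial_image fun i => MvPolynomial.X (ρ i)

end OMinimalStructure

section Graph

variable {𝒮 : OMinimalStructure} {n k : ℕ} {X : Set (Fin n → ℝ)} {f : (Fin n → ℝ) → (Fin k → ℝ)}

lemma append_eq_append_iff {α : Type*} {x x' : Fin n → α} {y y' : Fin k → α} :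
    Fin.append x y = Fin.append x' y' ↔ x = x' ∧ y = y' :=
  (Fin.appendEquiv n k).injective.eq_iff.trans (Prod.mk_inj (a₁ := x))

lemma append_mem_mapGraph {x : Fin n → ℝ} {y : Fin k → ℝ} :
    Fin.append x y ∈ mapGraph X f ↔ x ∈ X ∧ y = f x := by
  simp [mapGraph, append_eq_append_iff]

lemma mapGraph_eq_image : mapGraph X f = (fun x => Fin.append x (f x)) '' X := by
  simp only [mapGraph, Set.image, eq_comm]

lemma image_castAdd_mapGraph : (· ∘ Fin.castAdd k) '' mapGraph X f = X := by
  simp [mapGraph_eq_image, Set.image_image, Function.comp_def]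

lemma image_natAdd_mapGraph : (· ∘ Fin.natAdd n) '' mapGraph X f = f '' X := by
  simp [mapGraph_eq_image, Set.image_image, Function.comp_def]

lemma isBounded_image_comp {ι κ : Type*} {A : Set (κ → ℝ)}
    (hA : Bornology.IsBounded A) (ρ : ι → κ) : Bornology.IsBounded ((· ∘ ρ) '' A) := by
  rw [← Bornology.forall_isBounded_image_eval_iff] at hA ⊢
  exact fun i => by rw [Set.image_image]; exact hA (ρ i)

lemma isBounded_domain (hf : Bornology.IsBounded (mapGraph X f)) : Bornology.IsBounded X :=
  image_castAdd_mapGraph (X := X) (f := f) ▸ isBounded_image_comp hf _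

lemma isBounded_range (hf : Bornology.IsBounded (mapGraph X f)) : Bornology.IsBounded (f '' X) :=
  image_natAdd_mapGraph (X := X) (f := f) ▸ isBounded_image_comp hf _

lemma definable_domain (hf : 𝒮.Definable (mapGraph X f)) : 𝒮.Definable X :=
  image_castAdd_mapGraph (X := X) (f := f) ▸ hf.image_comp _

lemma definable_mapGraph_polynomial {l : ℕ} (hf : 𝒮.Definable (mapGraph X f))
    (p : Fin l → MvPolynomial (Fin k) ℝ) :
    𝒮.Definable (mapGraph X fun x i => MvPolynomial.eval (f x) (p i)) := by
  convert hf.polynomial_image (Fin.append (fun j => MvPolynomial.X (Fin.castAdd k j))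
    fun i => MvPolynomial.rename (Fin.natAdd n) (p i)) using 1
  rw [mapGraph_eq_image, mapGraph_eq_image, Set.image_image]
  refine Set.image_congr fun x _ => funext fun i => ?_
  have append_comp : Fin.append x (f x) ∘ Fin.natAdd n = f x := by ext i; simp
  cases i using Fin.addCases <;> simp [MvPolynomial.eval_rename, append_comp]

lemma definable_sublevel {φ : (Fin n → ℝ) → ℝ}
    (hφ : 𝒮.Definable (mapGraph X fun x (_ : Fin 1) => φ x)) (b : ℝ) :
    𝒮.Definable {x ∈ X | φ x < b} := by
  convert (hφ.inter (𝒮.definable_eval_lt (MvPolynomial.X (Fin.natAdd n 0))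
    (MvPolynomial.C b))).image_comp (Fin.castAdd 1) using 1
  ext x
  constructor
  · rintro ⟨hx, hb⟩
    exact ⟨_, ⟨⟨x, hx, rfl⟩, by simpa using hb⟩, by ext i; simp⟩
  · rintro ⟨_, ⟨⟨x, hx, rfl⟩, hb⟩, rfl⟩
    have append_comp : Fin.append x (fun _ : Fin 1 => φ x) ∘ Fin.castAdd 1 = x := by ext i; simp
    simpa [append_comp, hx] using hb

end Graph

section Slice

variable {n k : ℕ} {X : Set (Fin (n + 1) → ℝ)} {f : (Fin (n + 1) → ℝ) → (Fin k → ℝ)}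
  {i : Fin k} {j : Fin (n + 1)} {b : ℝ} {X' : Set (Fin n → ℝ)} {g : (Fin n → ℝ) → (Fin k → ℝ)}

/-- The coordinates of the ambient space of a slice `F ∩ {y_i = b}`, as coordinates of the ambient
space of `F`: the coordinate `x_j` takes the place of `y_i`. -/
def sliceCoord (i : Fin k) (j : Fin (n + 1)) : Fin (n + k) → Fin (n + 1 + k) :=
  Fin.append (Fin.castAdd k ∘ j.succAbove)
    (Function.update (Fin.natAdd (n + 1)) i (Fin.castAdd k j))

lemma append_comp_sliceCoord (x : Fin (n + 1) → ℝ) (y : Fin k → ℝ) :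
    Fin.append x y ∘ sliceCoord i j =
      Fin.append (j.removeNth x) (Function.update y i (x j)) := by
  ext l
  cases l using Fin.addCases with
  | left l => simp [sliceCoord, Fin.removeNth]
  | right l => by_cases hl : l = i <;> simp [sliceCoord, hl]

lemma IsSliceGraph.mapGraph_eq (hg : IsSliceGraph X f i j b X' g) :
    mapGraph X' g =
      (· ∘ sliceCoord i j) '' (mapGraph X f ∩ {z | z (Fin.natAdd (n + 1) i) = b}) := by
  ext z
  constructor
  · rintro ⟨x, hx, rfl⟩
    have hslice := hg (j.insertNth (g x i) x) (Function.update (g x) i b) (by simp)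
    simp only [Fin.removeNth_insertNth, Fin.insertNth_apply_same, Function.update_idem,
      Function.update_eq_self] at hslice
    refine ⟨_, ⟨hslice.2 ⟨x, hx, rfl⟩, by simp⟩, ?_⟩
    simp [append_comp_sliceCoord]
  · rintro ⟨_, ⟨⟨x, hx, rfl⟩, hb⟩, rfl⟩
    beta_reduce
    rw [append_comp_sliceCoord, ← hg _ _ (by simpa using hb)]
    exact ⟨x, hx, rfl⟩

lemma IsSliceGraph.definable {𝒮 : OMinimalStructure} (hg : IsSliceGraph X f i j b X' g)
    (hf : 𝒮.Definable (mapGraph X f)) : 𝒮.Definable (mapGraph X' g) := by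
  have hb := 𝒮.definable_eval_eq (MvPolynomial.X (Fin.natAdd (n + 1) i)) (MvPolynomial.C b)
  simp only [MvPolynomial.eval_X, MvPolynomial.eval_C] at hb
  exact hg.mapGraph_eq ▸ (hf.inter hb).image_comp _

lemma IsSliceGraph.isBounded (hg : IsSliceGraph X f i j b X' g)
    (hf : Bornology.IsBounded (mapGraph X f)) : Bornology.IsBounded (mapGraph X' g) :=
  hg.mapGraph_eq ▸ isBounded_image_comp (hf.subset Set.inter_subset_left) _

end Slice

section ExpMap

variable {𝒮 : OMinimalStructure} {ι : Type*} {n k : ℕ}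

/-- The coordinatewise exponential map: `expMap u` is the point with logarithmic coordinates `u`. -/
noncomputable def expMap (u : ι → ℝ) : ι → ℝ :=
  fun i => Real.exp (u i)

lemma isOpenEmbedding_expMap [Finite ι] :
    Topology.IsOpenEmbedding (expMap : (ι → ℝ) → ι → ℝ) :=
  .piMap fun _ => Real.isOpenEmbedding_exp

lemma append_expMap (u : Fin n → ℝ) (v : Fin k → ℝ) :
    Fin.append (expMap u) (expMap v) = expMap (Fin.append u v) := by
  ext i
  cases i using Fin.addCases <;> simp [expMap]

lemma ordConnected_compares {α : Type*} [LinearOrder α] (o : Ordering) (c : α) :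
    {x | o.Compares x c}.OrdConnected := by
  cases o
  · exact Set.ordConnected_Iio
  · exact Set.ordConnected_singleton
  · exact Set.ordConnected_Ioi

lemma IsCoordinateCone.convex_preimage_expMap {C : Set (Fin n → ℝ)} (hC : IsCoordinateCone C) :
    Convex ℝ (expMap ⁻¹' C) := by
  obtain ⟨J, σ, c, rfl⟩ := hC
  simp only [Set.ofPred_forall, Set.preimage_iInter]
  refine convex_iInter₂ fun j _ => ?_
  have hj : Convex ℝ {t : ℝ | (σ j).Compares (Real.exp t) (c j)} :=
    ((ordConnected_compares (σ j) (c j)).preimage_mono Real.exp_monotone).convex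
  exact hj.linear_preimage (LinearMap.proj (φ := fun _ => ℝ) j)

lemma isSemiMonotone_expMap_image {U : Set (Fin n → ℝ)} (hUo : IsOpen U) (hUc : Convex ℝ U)
    (hd : 𝒮.Definable (expMap '' U)) (hb : Bornology.IsBounded (expMap '' U)) :
    IsSemiMonotone 𝒮 (expMap '' U) where
  definable := hd
  isOpen := isOpenEmbedding_expMap.isOpenMap U hUo
  isBounded := hb
  connected C hC := by
    rw [← Set.image_inter_preimage]
    exact (hUc.inter hC.convex_preimage_expMap).isPreconnected.image _
      isOpenEmbedding_expMap.continuous.continuousOn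

lemma isSubmonotone_of_quasiconvexOn {U : Set (Fin n → ℝ)} {φ : (Fin n → ℝ) → ℝ}
    (hUo : IsOpen U) (hUc : Convex ℝ U) (hne : U.Nonempty)
    (hφ : QuasiconvexOn ℝ U (φ ∘ expMap)) (hcont : ContinuousOn φ (expMap '' U))
    (hd : 𝒮.Definable (mapGraph (expMap '' U) fun x (_ : Fin 1) => φ x))
    (hUb : Bornology.IsBounded (expMap '' U)) (hb : Bornology.IsBounded (φ '' (expMap '' U))) :
    IsSubmonotone 𝒮 (expMap '' U) φ where
  nonempty := hne.image _
  domain := isSemiMonotone_expMap_image hUo hUc (definable_domain hd) hUb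
  definable := hd
  bounded := hb
  usc := hcont.upperSemicontinuousOn
  sublevel b := by
    have hsub : {x ∈ expMap '' U | φ x < b} = expMap '' {u ∈ U | (φ ∘ expMap) u < b} :=
      (Set.image_inter_preimage expMap U {x | φ x < b}).symm
    have hopen : IsOpen {u ∈ U | (φ ∘ expMap) u < b} :=
      (hcont.comp isOpenEmbedding_expMap.continuous.continuousOn
        (Set.mapsTo_image _ _)).isOpen_inter_preimage hUo isOpen_Iio
    have hdef := definable_sublevel hd b
    have hbdd := hUb.subset (Set.sep_subset _ fun x => φ x < b)
    rw [hsub] at hdef hbdd ⊢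
    exact isSemiMonotone_expMap_image hopen (hφ.convex_lt b) hdef hbdd

end ExpMap

section MonomialMap

variable {𝒮 : OMinimalStructure} {n k : ℕ} {U : Set (Fin n → ℝ)}
  (A : (Fin n → ℝ) →ᵃ[ℝ] (Fin k → ℝ))

/-- The generalised monomial map `x ↦ (c_i * ∏ j, x_j ^ q_ij)_i` on positive points, given in
logarithmic coordinates by the affine map `A` with linear part `q` and constant part `log c`. -/
noncomputable def monomialMap (x : Fin n → ℝ) : Fin k → ℝ :=
  expMap (A fun l => Real.log (x l))

@[simp]
lemma monomialMap_expMap (u : Fin n → ℝ) : monomialMap A (expMap u) = expMap (A u) := by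
  simp [monomialMap, expMap]

lemma mapGraph_monomialMap :
    mapGraph (expMap '' U) (monomialMap A) = expMap '' mapGraph U A := by
  simp only [mapGraph_eq_image, Set.image_image, monomialMap_expMap, append_expMap]

lemma continuousOn_monomialMap : ContinuousOn (monomialMap A) (expMap '' U) := by
  rintro _ ⟨u, -, rfl⟩
  refine (isOpenEmbedding_expMap.continuousAt_iff.1 ?_).continuousWithinAt
  have hA : Continuous fun u => expMap (A u) :=
    isOpenEmbedding_expMap.continuous.comp A.continuous_of_finiteDimensional
  exact hA.continuousAt.congr (.of_forall fun u => (monomialMap_expMap A u).symm)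

lemma isBoundedContinuousMap_monomialMap (hUo : IsOpen U) (hUc : Convex ℝ U) (hne : U.Nonempty)
    (hd : 𝒮.Definable (mapGraph (expMap '' U) (monomialMap A)))
    (hb : Bornology.IsBounded (mapGraph (expMap '' U) (monomialMap A))) :
    IsBoundedContinuousMap 𝒮 (expMap '' U) (monomialMap A) where
  nonempty := hne.image _
  domain := isSemiMonotone_expMap_image hUo hUc (definable_domain hd) (isBounded_domain hb)
  definable := hd
  bounded := isBounded_range hb
  continuousOn := continuousOn_monomialMap A

variable {A}

lemma eq_smul_single {R : Type*} [MulZeroOneClass R] {ι : Type*} [DecidableEq ι] {z : ι → R}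
    {j : ι} (hz : ∀ l, l ≠ j → z l = 0) : z = z j • Pi.single j 1 := by
  ext l
  rcases eq_or_ne l j with rfl | hl
  · simp
  · simp [hl, hz l hl]

lemma affineMap_sub_apply_of_eq_off {u v : Fin n → ℝ} {j : Fin n} (huv : ∀ l, l ≠ j → u l = v l)
    (i : Fin k) : A v i - A u i = (v j - u j) * A.linear (Pi.single j 1) i := by
  have hsub : v - u = (v - u) j • Pi.single j (1 : ℝ) :=
    eq_smul_single fun l hl => sub_eq_zero.2 (huv l hl).symm
  rw [← Pi.sub_apply, ← vsub_eq_sub, ← A.linearMap_vsub, vsub_eq_sub, hsub, map_smul]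
  simp

lemma expMap_affineMap_lt_iff {u v : Fin n → ℝ} {i : Fin k} {j : Fin n}
    (huv : ∀ l, l ≠ j → expMap u l = expMap v l) :
    expMap (A u) i < expMap (A v) i ↔ 0 < (v j - u j) * A.linear (Pi.single j 1) i := by
  rw [← affineMap_sub_apply_of_eq_off (fun l hl => Real.exp_injective (huv l hl)), sub_pos]
  exact Real.exp_lt_exp

lemma strictIncrIn_monomialMap {i : Fin k} {j : Fin n} (h : 0 < A.linear (Pi.single j 1) i) :
    StrictIncrIn (expMap '' U) (fun x => monomialMap A x i) j := by
  rintro _ ⟨u, -, rfl⟩ _ ⟨v, -, rfl⟩ huv hlt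
  simp only [monomialMap_expMap]
  exact (expMap_affineMap_lt_iff huv).2 (mul_pos (sub_pos.2 (Real.exp_lt_exp.1 hlt)) h)

lemma strictDecrIn_monomialMap {i : Fin k} {j : Fin n} (h : A.linear (Pi.single j 1) i < 0) :
    StrictDecrIn (expMap '' U) (fun x => monomialMap A x i) j := by
  rintro _ ⟨u, -, rfl⟩ _ ⟨v, -, rfl⟩ huv hlt
  simp only [monomialMap_expMap]
  exact (expMap_affineMap_lt_iff fun l hl => (huv l hl).symm).2
    (mul_pos_of_neg_of_neg (sub_neg.2 (Real.exp_lt_exp.1 hlt)) h)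

lemma independentOf_monomialMap {i : Fin k} {j : Fin n} (h : A.linear (Pi.single j 1) i = 0) :
    IndependentOf (expMap '' U) (fun x => monomialMap A x i) j := by
  rintro _ ⟨u, -, rfl⟩ _ ⟨v, -, rfl⟩ huv
  simp only [monomialMap_expMap]
  refine le_antisymm (not_lt.1 ?_) (not_lt.1 ?_)
  · simp [expMap_affineMap_lt_iff fun l hl => (huv l hl).symm, h]
  · simp [expMap_affineMap_lt_iff huv, h]

lemma isMonotoneFun_monomialMap (hUo : IsOpen U) (hUc : Convex ℝ U) (hne : U.Nonempty)
    (hd : 𝒮.Definable (mapGraph (expMap '' U) (monomialMap A)))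
    (hb : Bornology.IsBounded (mapGraph (expMap '' U) (monomialMap A))) (i : Fin k) :
    IsMonotoneFun 𝒮 (expMap '' U) (fun x => monomialMap A x i) := by
  let φ : (Fin n → ℝ) →ᵃ[ℝ] ℝ := (LinearMap.proj i).toAffineMap.comp A
  have hexp : (fun x => monomialMap A x i) ∘ expMap = Real.exp ∘ φ :=
    funext fun u => congrFun (monomialMap_expMap A u) i
  have hcont : ContinuousOn (fun x => monomialMap A x i) (expMap '' U) :=
    (continuous_apply i).comp_continuousOn (continuousOn_monomialMap A)
  have hbi : Bornology.IsBounded ((fun x => monomialMap A x i) '' (expMap '' U)) := by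
    simpa only [Set.image_image] using
      Bornology.forall_isBounded_image_eval_iff.2 (isBounded_range hb) i
  refine ⟨isSubmonotone_of_quasiconvexOn hUo hUc hne ?_ hcont ?_ (isBounded_domain hb) hbi,
    isSubmonotone_of_quasiconvexOn hUo hUc hne ?_ hcont.neg ?_ (isBounded_domain hb) ?_,
    fun j => ?_⟩
  · rw [hexp]
    exact ((convexOn_exp.comp_affineMap φ).subset (Set.subset_univ U) hUc).quasiconvexOn
  · simpa only [MvPolynomial.eval_X] using
      definable_mapGraph_polynomial hd fun _ : Fin 1 => MvPolynomial.X i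
  · have hneg : (fun x => -monomialMap A x i) ∘ expMap = (fun t => -Real.exp t) ∘ φ :=
      congrArg (fun g u => -g u) hexp
    rw [hneg]
    have hφ : ConcaveOn ℝ U φ :=
      ((concaveOn_id convex_univ).comp_affineMap φ).subset (Set.subset_univ U) hUc
    exact hφ.quasiconcaveOn.antitone_comp Real.exp_monotone.neg
  · simpa only [map_neg, MvPolynomial.eval_X] using
      definable_mapGraph_polynomial hd fun _ : Fin 1 => -MvPolynomial.X i
  · simpa only [← Set.image_neg_eq_neg, Set.image_image] using hbi.neg
  · rcases lt_trichotomy (A.linear (Pi.single j 1) i) 0 with h | h | h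
    · exact .inr (.inl (strictDecrIn_monomialMap h))
    · exact .inr (.inr (independentOf_monomialMap h))
    · exact .inl (strictIncrIn_monomialMap h)

end MonomialMap

section BasisSets

lemma injOn_affineMap_iff {E F : Type*} [AddCommGroup E] [Module ℝ E] [TopologicalSpace E]
    [ContinuousAdd E] [ContinuousSMul ℝ E] [AddCommGroup F] [Module ℝ F] {U : Set E}
    (hU : IsOpen U) (hne : U.Nonempty) (A : E →ᵃ[ℝ] F) :
    Set.InjOn A U ↔ Function.Injective A.linear := by
  refine ⟨fun hA => ?_, fun hA => (A.linear_injective_iff.1 hA).injOn⟩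
  rw [injective_iff_map_eq_zero]
  intro z hz
  obtain ⟨u, hu⟩ := hne
  have hcont : ContinuousAt (fun t : ℝ => t • z + u) 0 := by fun_prop
  have hnear : ∀ᶠ t in nhdsWithin (0 : ℝ) {0}ᶜ, t • z + u ∈ U :=
    (hcont.eventually_mem (hU.mem_nhds (by simpa using hu))).filter_mono nhdsWithin_le_nhds
  obtain ⟨t, htU, ht⟩ := (hnear.and self_mem_nhdsWithin).exists
  have hAt : A (t • z + u) = A u := by simpa [hz] using A.map_vadd u (t • z)
  simpa [Set.mem_compl_singleton_iff.1 ht] using hA htU hu hAt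

lemma basisSets_monomialMap {n k : ℕ} {U : Set (Fin n → ℝ)} (hU : IsOpen U) (hne : U.Nonempty)
    (A : (Fin n → ℝ) →ᵃ[ℝ] (Fin k → ℝ)) :
    basisSets (expMap '' U) (monomialMap A) = basisSets Set.univ A.linear := by
  ext H
  let graphMap : (Fin n → ℝ) →ᵃ[ℝ] (Fin n ⊕ Fin k → ℝ) :=
    (LinearEquiv.sumArrowLequivProdArrow (Fin n) (Fin k) ℝ ℝ).symm.toLinearMap.toAffineMap.comp
      ((AffineMap.id ℝ _).prod A)
  let coordMap : (Fin n → ℝ) →ᵃ[ℝ] (H → ℝ) :=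
    (LinearMap.funLeft ℝ ℝ (Subtype.val : H → Fin n ⊕ Fin k)).toAffineMap.comp graphMap
  have hexp : (fun x (h : H) => Sum.elim x (monomialMap A x) h.1) ∘ expMap =
      expMap ∘ coordMap := by
    ext u ⟨l | r, _⟩
    · rfl
    · exact congrFun (monomialMap_expMap A u) r
  have hlin : (fun u (h : H) => Sum.elim u (A.linear u) h.1) = coordMap.linear := by
    ext u ⟨l | r, _⟩ <;> rfl
  have hinj : Set.InjOn (fun x (h : H) => Sum.elim x (monomialMap A x) h.1) (expMap '' U) ↔
      Set.InjOn (fun u (h : H) => Sum.elim u (A.linear u) h.1) Set.univ := by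
    rw [← isOpenEmbedding_expMap.injective.injOn.comp_iff, hexp, hlin, Set.injOn_univ,
      ← injOn_affineMap_iff hU hne]
    exact ⟨Set.InjOn.of_comp, isOpenEmbedding_expMap.injective.comp_injOn⟩
  exact and_congr_right fun _ => hinj

end BasisSets

section AffineSlice

variable {n k : ℕ} {i : Fin k} {j : Fin (n + 1)}

/-- Linear coordinates on `ℝⁿ⁺¹` in which a functional `φ` takes the place of the `j`-th
coordinate, provided that `φ` depends on that coordinate. -/
noncomputable def pivotEquiv (φ : (Fin (n + 1) → ℝ) →ₗ[ℝ] ℝ) (h : φ (Pi.single j 1) ≠ 0) :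
    (Fin (n + 1) → ℝ) ≃ₗ[ℝ] (Fin n → ℝ) × ℝ :=
  .ofInjectiveOfFinrankEq ((LinearMap.funLeft ℝ ℝ j.succAbove).prod φ)
    (by
      rw [injective_iff_map_eq_zero]
      intro z hz
      obtain ⟨hzj, hφ⟩ := Prod.mk_eq_zero.1 hz
      have hz_single : z = z j • Pi.single j 1 :=
        eq_smul_single fun l hl => by
          obtain ⟨l, rfl⟩ := Fin.exists_succAbove_eq hl
          exact congrFun hzj l
      rw [hz_single, map_smul, smul_eq_mul] at hφ
      rw [hz_single, (mul_eq_zero_iff_right h).1 hφ, zero_smul])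
    (by simp)

variable (A : (Fin (n + 1) → ℝ) →ᵃ[ℝ] (Fin k → ℝ)) (h : A.linear (Pi.single j 1) i ≠ 0) (β : ℝ)

/-- The affine parametrisation of the hyperplane `{u | A u i = β}` by the coordinates of `u` other
than `u j`. -/
noncomputable def hyperplaneParam : (Fin n → ℝ) →ᵃ[ℝ] (Fin (n + 1) → ℝ) :=
  (pivotEquiv (LinearMap.proj i ∘ₗ A.linear) h).symm.toLinearMap.toAffineMap.comp
    ((AffineMap.id ℝ _).prod (AffineMap.const ℝ _ (β - A 0 i)))

/-- The affine map whose graph is the slice `{y_i = β}` of the graph of `A`, with `x_j` in the place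
of `y_i`. -/
noncomputable def affineSlice : (Fin n → ℝ) →ᵃ[ℝ] (Fin k → ℝ) :=
  AffineMap.pi (Function.update
    (fun r => (LinearMap.proj r).toAffineMap.comp (A.comp (hyperplaneParam A h β))) i
    ((LinearMap.proj j).toAffineMap.comp (hyperplaneParam A h β)))

variable {A}

lemma hyperplaneParam_eq_iff {u : Fin (n + 1) → ℝ} {v : Fin n → ℝ} :
    hyperplaneParam A h β v = u ↔ j.removeNth u = v ∧ A u i = β := by
  have hA : A u i = A.linear u i + A 0 i := congrFun (congrFun A.decomp u) i
  have hpivot : pivotEquiv (LinearMap.proj i ∘ₗ A.linear) h u = (j.removeNth u, A.linear u i) :=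
    rfl
  rw [hA, ← eq_sub_iff_add_eq, ← Prod.mk_inj, ← hpivot]
  exact (LinearEquiv.symm_apply_eq _).trans eq_comm

lemma affineSlice_apply (v : Fin n → ℝ) :
    affineSlice A h β v =
      Function.update (A (hyperplaneParam A h β v)) i (hyperplaneParam A h β v j) := by
  ext r
  rcases eq_or_ne r i with rfl | hr
  · simp [affineSlice]
  · simp [affineSlice, hr]

lemma affineSlice_linear (γ : ℝ) :
    (affineSlice A h β).linear = (affineSlice A h γ).linear := by
  ext u r
  rcases eq_or_ne r i with rfl | hr
  · simp [affineSlice, hyperplaneParam]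
  · simp [affineSlice, hyperplaneParam, hr]

lemma isSliceGraph_monomialMap {U : Set (Fin (n + 1) → ℝ)} :
    IsSliceGraph (expMap '' U) (monomialMap A) i j (Real.exp β)
      (expMap '' (hyperplaneParam A h β ⁻¹' U)) (monomialMap (affineSlice A h β)) := by
  intro x y hy
  simp only [append_mem_mapGraph]
  constructor
  · rintro ⟨⟨u, hu, rfl⟩, rfl⟩
    rw [monomialMap_expMap] at hy ⊢
    have hv : hyperplaneParam A h β (j.removeNth u) = u :=
      (hyperplaneParam_eq_iff h β).2 ⟨rfl, Real.exp_injective hy⟩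
    refine ⟨⟨j.removeNth u, by rwa [Set.mem_preimage, hv], rfl⟩, ?_⟩
    change _ = monomialMap (affineSlice A h β) (expMap (j.removeNth u))
    rw [monomialMap_expMap, affineSlice_apply, hv]
    exact (Function.comp_update Real.exp _ _ _).symm
  · rintro ⟨⟨v, hv, hvx⟩, hxy⟩
    set u := hyperplaneParam A h β v with hu
    obtain ⟨hremove, hA⟩ := (hyperplaneParam_eq_iff h β).1 hu.symm
    rw [← hvx, monomialMap_expMap, affineSlice_apply, ← hu] at hxy
    have hupdate : Function.update y i (x j) = Function.update (expMap (A u)) i (Real.exp (u j)) :=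
      hxy.trans (Function.comp_update Real.exp _ _ _)
    have hxj : x j = Real.exp (u j) := by simpa using congrFun hupdate i
    have hx : x = expMap u := by
      rw [← Fin.insertNth_self_removeNth j x, Fin.insertNth_eq_iff, ← hvx, ← hremove]
      exact ⟨hxj, rfl⟩
    refine ⟨⟨u, hv, hx.symm⟩, ?_⟩
    rw [hx, monomialMap_expMap]
    ext r
    rcases eq_or_ne r i with rfl | hr
    · rw [hy, ← hA, expMap]
    · simpa [hr] using congrFun hupdate r

end AffineSlice

lemma isMonotoneMap_monomialMap {𝒮 : OMinimalStructure} {n k : ℕ} {U : Set (Fin n → ℝ)}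
    {A : (Fin n → ℝ) →ᵃ[ℝ] (Fin k → ℝ)} (hUo : IsOpen U) (hUc : Convex ℝ U) (hne : U.Nonempty)
    (hd : 𝒮.Definable (mapGraph (expMap '' U) (monomialMap A)))
    (hb : Bornology.IsBounded (mapGraph (expMap '' U) (monomialMap A))) :
    IsMonotoneMap 𝒮 n (expMap '' U) (monomialMap A) := by
  induction n with
  | zero => exact isBoundedContinuousMap_monomialMap A hUo hUc hne hd hb
  | succ n ih =>
    have hbc := isBoundedContinuousMap_monomialMap A hUo hUc hne hd hb
    cases n with
    | zero => exact ⟨hbc, isMonotoneFun_monomialMap hUo hUc hne hd hb⟩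
    | succ n =>
      refine ⟨hbc, fun i j hij => ?_⟩
      have h : A.linear (Pi.single j 1) i ≠ 0 := fun h => hij (independentOf_monomialMap h)
      refine ⟨basisSets Set.univ (affineSlice A h 0).linear, ?_⟩
      rintro _ ⟨_, ⟨u, hu, rfl⟩, rfl⟩
      rw [monomialMap_expMap]
      set β := A u i
      have hslice := isSliceGraph_monomialMap h β (U := U)
      have hUo' : IsOpen (hyperplaneParam A h β ⁻¹' U) :=
        hUo.preimage (hyperplaneParam A h β).continuous_of_finiteDimensional
      have hUc' : Convex ℝ (hyperplaneParam A h β ⁻¹' U) := hUc.affine_preimage _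
      have hne' : (hyperplaneParam A h β ⁻¹' U).Nonempty :=
        ⟨j.removeNth u, by
          rwa [Set.mem_preimage, (hyperplaneParam_eq_iff h β).2 ⟨rfl, rfl⟩]⟩
      refine ⟨_, _, hslice,
        ih hUo' hUc' hne' (hslice.definable hd) (hslice.isBounded hb), ?_⟩
      rw [basisSets_monomialMap hUo' hne', affineSlice_linear h β 0]

section LinearImage

lemma exists_equiv_linearIndependent {K V : Type*} [Field K] [AddCommGroup V] [Module K V] {n : ℕ}
    (A : Fin n → V) :
    ∃ (m k : ℕ) (e : Fin (m + k) ≃ Fin n),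
      LinearIndependent K (fun j : Fin m => A (e (Fin.castAdd k j))) ∧
      ∀ i, A i ∈ Submodule.span K (Set.range fun j : Fin m => A (e (Fin.castAdd k j))) := by
  classical
  obtain ⟨κ, p, hp, hspan, hli⟩ := exists_linearIndependent' K A
  have : Fintype κ := @Fintype.ofFinite κ (Finite.of_injective p hp)
  let eκ : Fin (Fintype.card κ) ≃ κ := (Fintype.equivFin κ).symm
  let ec : Fin (Fintype.card ↥(Set.range p)ᶜ) ≃ ↥(Set.range p)ᶜ := (Fintype.equivFin _).symm
  let e := finSumFinEquiv.symm.trans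
    (((eκ.trans (Equiv.ofInjective p hp)).sumCongr ec).trans (Equiv.Set.sumCompl (Set.range p)))
  have he : (fun j => A (e (Fin.castAdd _ j))) = (A ∘ p) ∘ eκ := by
    ext j
    simp [e]
  refine ⟨_, _, e, ?_, fun i => ?_⟩
  · rw [he]
    exact hli.comp _ eκ.injective
  · rw [he, eκ.surjective.range_comp, hspan]
    exact Submodule.subset_span ⟨i, rfl⟩

lemma surjective_pi_of_linearIndependent {K E ι : Type*} [Field K] [AddCommGroup E] [Module K E]
    [Finite ι] {φ : ι → Module.Dual K E} (hφ : LinearIndependent K φ) :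
    Function.Surjective (LinearMap.pi φ) := by
  classical
  have := Fintype.ofFinite ι
  rw [← LinearMap.dualMap_injective_iff, injective_iff_map_eq_zero]
  intro ψ hψ
  have hsum : ∑ i, ψ (Pi.single i 1) • φ i = 0 := by
    ext u
    have hu : ψ (LinearMap.pi φ u) = 0 := LinearMap.congr_fun hψ u
    rw [pi_eq_sum_univ' (LinearMap.pi φ u), map_sum] at hu
    simpa [mul_comm] using hu
  refine LinearMap.pi_ext' fun i => LinearMap.ext_ring ?_
  exact Fintype.linearIndependent_iff.1 hφ _ hsum i

lemma exists_reindex_eq_append {K E : Type*} [Field K] [AddCommGroup E] [Module K E] {n : ℕ}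
    (M : E →ₗ[K] (Fin n → K)) :
    ∃ (m k : ℕ) (e : Fin (m + k) ≃ Fin n) (P : E →ₗ[K] (Fin m → K))
      (Q : (Fin m → K) →ₗ[K] (Fin k → K)),
      Function.Surjective P ∧ ∀ u, M u ∘ e = Fin.append (P u) (Q (P u)) := by
  obtain ⟨m, k, e, hli, hspan⟩ :=
    exists_equiv_linearIndependent (K := K) fun i => LinearMap.proj i ∘ₗ M
  choose q hq using fun r : Fin k =>
    (Submodule.mem_span_range_iff_exists_fun K).1 (hspan (e (Fin.natAdd m r)))
  refine ⟨m, k, e, _, (Matrix.of q).mulVecLin, surjective_pi_of_linearIndependent hli,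
    fun u => funext fun l => ?_⟩
  cases l using Fin.addCases with
  | left l => simp
  | right r => simpa [Matrix.mulVec, dotProduct] using (LinearMap.congr_fun (hq r) u).symm

lemma isGraphOfMonotoneMap_expMap_image {𝒮 : OMinimalStructure} {E : Type*} [AddCommGroup E]
    [Module ℝ E] [TopologicalSpace E] [IsTopologicalAddGroup E] [ContinuousSMul ℝ E]
    {n : ℕ} {W : Set E} (hWo : IsOpen W) (hWc : Convex ℝ W) (hne : W.Nonempty)
    (M : E →ₗ[ℝ] (Fin n → ℝ)) (hd : 𝒮.Definable (expMap '' (M '' W)))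
    (hb : Bornology.IsBounded (expMap '' (M '' W))) :
    IsGraphOfMonotoneMap 𝒮 (expMap '' (M '' W)) := by
  obtain ⟨m, k, e, P, Q, hP, hM⟩ := exists_reindex_eq_append M
  have hgraph : (· ∘ e) '' (expMap '' (M '' W)) =
      mapGraph (expMap '' (P '' W)) (monomialMap Q.toAffineMap) := by
    rw [mapGraph_monomialMap]
    simp only [mapGraph_eq_image, Set.image_image, LinearMap.coe_toAffineMap, ← hM]
    rfl
  refine ⟨m, k, e, expMap '' (P '' W), monomialMap Q.toAffineMap, ?_, ?_⟩
  · refine isMonotoneMap_monomialMap ?_ (hWc.linear_image P) (hne.image P) ?_ ?_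
    · exact P.isOpenMap_of_finiteDimensional hP W hWo
    · exact hgraph ▸ hd.image_comp e
    · exact hgraph ▸ isBounded_image_comp hb e
  · rw [← hgraph]
    exact (Set.preimage_image_eq _ e.surjective.injective_comp_right).symm

end LinearImage

lemma definable_openToricCube (𝒮 : OMinimalStructure) {d n : ℕ} (a : Fin n → Fin d → ℕ) :
    𝒮.Definable (openToricCube a) := by
  have hcube : 𝒮.Definable {t : Fin d → ℝ | ∀ l, t l ∈ Set.Ioo (0 : ℝ) 1} :=
    𝒮.definable_forall (A := fun l => {t | t l ∈ Set.Ioo (0 : ℝ) 1}) fun l => by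
      convert (𝒮.definable_eval_lt 0 (MvPolynomial.X l)).inter
        (𝒮.definable_eval_lt (MvPolynomial.X l) 1) using 1
      ext t
      simp
  simpa [openToricCube] using hcube.polynomial_image fun i => ∏ l, MvPolynomial.X l ^ a i l

lemma isBounded_openToricCube {d n : ℕ} (a : Fin n → Fin d → ℕ) :
    Bornology.IsBounded (openToricCube a) := by
  refine (Metric.isBounded_Icc (0 : Fin n → ℝ) 1).subset ?_
  rintro _ ⟨t, ht, rfl⟩
  have hpow (i l) : 0 ≤ t l ^ a i l := pow_nonneg (ht l).1.le _
  exact ⟨fun i => Finset.prod_nonneg fun l _ => hpow i l,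
    fun i => Finset.prod_le_one (fun l _ => hpow i l)
      fun l _ => pow_le_one₀ (ht l).1.le (ht l).2.le⟩

lemma openToricCube_eq_expMap_image {d n : ℕ} (a : Fin n → Fin d → ℕ) :
    openToricCube a = expMap '' ((Matrix.of fun i l => (a i l : ℝ)).mulVecLin ''
      Set.univ.pi fun _ => Set.Iio 0) := by
  have hcube : {t : Fin d → ℝ | ∀ l, t l ∈ Set.Ioo (0 : ℝ) 1} =
      expMap '' Set.univ.pi fun _ => Set.Iio 0 := by
    ext t
    refine ⟨fun ht => ⟨fun l => Real.log (t l), fun l _ => Real.log_neg (ht l).1 (ht l).2,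
      funext fun l => Real.exp_log (ht l).1⟩, ?_⟩
    rintro ⟨u, hu, rfl⟩ l
    exact ⟨Real.exp_pos _, Real.exp_lt_one_iff.2 (hu l trivial)⟩
  rw [openToricCube, hcube, Set.image_image, Set.image_image]
  refine Set.image_congr fun u _ => funext fun i => ?_
  simp [expMap, Matrix.mulVec, dotProduct, Real.exp_sum, Real.exp_nat_mul]

theorem theorem6p2 (𝒮 : OMinimalStructure) {d n : ℕ} (a : Fin n → Fin d → ℕ) :
    IsGraphOfMonotoneMap 𝒮 (openToricCube a) := by
  have hd := definable_openToricCube 𝒮 a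
  have hb := isBounded_openToricCube a
  rw [openToricCube_eq_expMap_image] at hd hb ⊢
  exact isGraphOfMonotoneMap_expMap_image (isOpen_set_pi Set.finite_univ fun _ _ => isOpen_Iio)
    (convex_pi fun _ _ => convex_Iio 0) (Set.univ_pi_nonempty_iff.2 fun _ => Set.nonempty_Iio)
    _ hd hb
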